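/- Let $k\ge 1$, let $\alpha_1,\dots,\alpha_k\in(1,2)$ and let $l_1,\dots,l_k>0$ be real constants. For $\boldsymbol\theta\in[-\pi,\pi]^k$ put $$q_{\boldsymbol\alpha}(\boldsymbol\theta)=\sum_{i=1}^k l_i|\theta_i|^{\alpha_i},\qquad r_{\boldsymbol\alpha}(\boldsymbol\theta)=\sum_{i=1}^k l_i\left|2\sin\tfrac{\theta_i}{2}\right|^{\alpha_i}.$$ Let $p_{\boldsymbol\alpha}\in L^1([-\pi,\pi]^k)$ be real-valued and even (that is, $p_{\boldsymbol\alpha}(-\boldsymbol\theta)=p_{\boldsymbol\alpha}(\boldsymbol\theta)$ for almost every $\boldsymbol\theta$), and suppose that there are constants $c_0>0$ and $c_1$ with $$c_0\le \frac{p_{\boldsymbol\alpha}(\boldsymbol\theta)}{q_{\boldsymbol\alpha}(\boldsymbol\theta)}\le c_1\qquad\text{for almost every }\boldsymbol\theta\in[-\pi,\pi]^k .$$ For a multi-index $\mathbf n=(n_1,\dots,n_k)$ of positive integers and $f\in L^1([-\pi,\pi]^k)$ let $T_{\mathbf n}(f)=[\hat f_{\mathbf i-\mathbf j}]_{\mathbf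 i,\mathbf j=\mathbf 1}^{\mathbf n}$ be the $k$-level Toeplitz matrix of size $n_1\cdots n_k$ with $\hat f_{\mathbf j}=(2\pi)^{-k}\int_{[-\pi,\pi]^k}f(\boldsymbol\theta)e^{\iota\langle\mathbf j,\boldsymbol\theta\rangle}\,d\boldsymbol\theta$. For a symmetric Toeplitz matrix $T=[t_{|i-j|}]_{i,j=1}^n$ let $\tau(T)=T-H(T)$, where $H(T)$ is the $n\times n$ Hankel matrix with $(i,j)$ entry $t_{i+j}$ if $i+j\le n-1$, $t_{2n+2-i-j}$ if $i+j\ge n+3$, and $0$ otherwise. For a $k$-level matrix that is symmetric Toeplitz at each level, $\tau$ is applied linearly and at every level, so that $\tau(T_1\otimes\cdots\otimes T_k)=\tau(T_1)\otimes\cdots\otimes\tau(T_k)$. Put $B_{\mathbf n}=T_{\mathbf n}(p_{\boldsymbol\alpha})$ and $R_{\mathbf n}=T_{\mathbf n}(r_{\boldsymbol\alpha})$. Then for every multi-index $\mathbf n$ of positive integers the matrix $\tau(R_{\mathbf n})$ is invertible, and every eigenvalue $\lambda$ of $\tau(R_{\mathbf n})^{-1}B_{\mathbf n}$ is real and satisfies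 $$\frac{c_0}{2}\le\lambda\le\frac{3\pi^2c_1}{8}.$$ -/

import Mathlib

open MeasureTheory

noncomputable section

namespace MultilevelToeplitz

/-- The cube `[-π, π]^k`. -/
def cube (k : ℕ) : Set (Fin k → ℝ) := Set.Icc (fun _ => -Real.pi) (fun _ => Real.pi)

/-- The Fourier coefficient `(2π)^{-k} ∫_{[-π,π]^k} f(θ) e^{i⟨j,θ⟩} dθ` (with the sign convention of
the positive exponent). -/
def fourierCoefficient {k : ℕ} (f : (Fin k → ℝ) → ℝ) (j : Fin k → ℤ) : ℂ :=
  ((2 * Real.pi : ℝ) ^ k : ℂ)⁻¹ *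
    ∫ θ in cube k, (f θ : ℂ) * Complex.exp (Complex.I * ((∑ t, (j t : ℝ) * θ t : ℝ) : ℂ))

/-- The `k`-level Toeplitz matrix `T_n(f)` of the generating function `f`. Rows and columns are
indexed by multi-indices, so that the size is `n₁ ⋯ n_k`; indices start from `0`. -/
def toeplitz {k : ℕ} (n : Fin k → ℕ) (f : (Fin k → ℝ) → ℝ) :
    Matrix (∀ r, Fin (n r)) (∀ r, Fin (n r)) ℂ :=
  Matrix.of fun i j => fourierCoefficient f (fun r => ((i r : ℕ) : ℤ) - ((j r : ℕ) : ℤ))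

/-- The unilevel symmetric Toeplitz matrix `[t_{|i-j|}]` of size `n`. -/
def symToeplitz (n : ℕ) (t : ℕ → ℂ) : Matrix (Fin n) (Fin n) ℂ :=
  Matrix.of fun i j => t (Nat.dist i j)

/-- The Hankel matrix of size `n` with constant antidiagonals
`t_2, …, t_{n-1}, 0, 0, 0, t_{n-1}, …, t_2`. With indices starting from `1` the entry `(i, j)` is
`t_{i+j}` if `i + j ≤ n - 1`, `t_{2n+2-i-j}` if `i + j ≥ n + 3`, and `0` otherwise; in the code the
indices start from `0`. -/
def hankelCorrection (n : ℕ) (t : ℕ → ℂ) : Matrix (Fin n) (Fin n) ℂ :=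
  Matrix.of fun i j =>
    if (i : ℕ) + j + 3 ≤ n then t (i + j + 2)
    else if n + 1 ≤ (i : ℕ) + j then t (2 * n - (i + j))
    else 0

/-- The unilevel `τ` matrix `τ(T) = T - H(T)` of the symmetric Toeplitz matrix
`T = [t_{|i-j|}]`. -/
def tauUnilevel (n : ℕ) (t : ℕ → ℂ) : Matrix (Fin n) (Fin n) ℂ :=
  symToeplitz n t - hankelCorrection n t

/-- The multilevel `τ` matrix of a `k`-level matrix `A` that is symmetric Toeplitz at each level.
Such an `A` is the sum, over the multi-indices `m` with `0 ≤ m_r < n_r`, of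
`a_m S_{m_1} ⊗ ⋯ ⊗ S_{m_k}`, where `a_m` is the entry of `A` in the first row and column `m`, and
`S_m` is the unilevel symmetric Toeplitz matrix with ones where `|i - j| = m` and zeros elsewhere;
`τ` is applied linearly and on every level:
`τ(A) = ∑_m a_m τ(S_{m_1}) ⊗ ⋯ ⊗ τ(S_{m_k})`. -/
def tau {k : ℕ} (n : Fin k → ℕ) [∀ r, NeZero (n r)]
    (A : Matrix (∀ r, Fin (n r)) (∀ r, Fin (n r)) ℂ) :
    Matrix (∀ r, Fin (n r)) (∀ r, Fin (n r)) ℂ :=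
  Matrix.of fun i j => ∑ m : ∀ r, Fin (n r),
    A (fun _ => 0) m * ∏ r, tauUnilevel (n r) (Pi.single (m r : ℕ) 1) (i r) (j r)

/-- `q_α(θ) = ∑ l_i |θ_i|^{α_i}`. -/
def qFun {k : ℕ} (l α : Fin k → ℝ) (θ : Fin k → ℝ) : ℝ := ∑ i, l i * |θ i| ^ α i

/-- `r_α(θ) = ∑ l_i |2 sin(θ_i / 2)|^{α_i}`. -/
def rFun {k : ℕ} (l α : Fin k → ℝ) (θ : Fin k → ℝ) : ℝ :=
  ∑ i, l i * |2 * Real.sin (θ i / 2)| ^ α i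

end MultilevelToeplitz

end

/-! An eigenvalue of `τ(R)⁻¹B` is a quotient of the Hermitian forms of `B` and `τ(R)`, so it
suffices to compare both forms with that of `R`. `B` against `R`: a Toeplitz form is the integral of
the symbol against `|trigPoly|²`, and `r ≤ q ≤ (π²/4) r` on the cube, whence `c₀ R ≤ B ≤ c₁ (π²/4)
R` (`exists_toeplitz_form`, `rFun_bounds`). `R` against `τ(R)`: the claim `τ(R)/2 ≤ R ≤ 3τ(R)/2`
with `τ(R) = R - H` says exactly that `R + H ≥ 0` and `R - 3H ≥ 0`. Both follow from strict diagonal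
dominance of `T + cH` at each level for `-3 ≤ c ≤ 1` (`rieszGap_le_diag_sub_sum`), a property that
weighted Kronecker sums inherit (`gap_kronSum`). The dominance rests on three facts about the
Fourier coefficients `t_m` of `|2 sin(θ/2)|^a`, `0 < a < 2`, all drawn from one two-term recurrence:
`t_m < 0` for `m ≥ 1`, `t_m` is nondecreasing there, and every partial sum `t_0 + 2(t_1 + ⋯ + t_N)`
is positive. -/

namespace MultilevelToeplitz

/-! ### Signs, monotonicity and partial sums of the unilevel Fourier coefficients. -/

open Real in
/-- The `m`-th Fourier coefficient of the even function `|2 sin (θ / 2)| ^ a`, as a cosine integral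
over `[0, π]`. -/
noncomputable def rieszCoeff (a : ℝ) (m : ℕ) : ℝ :=
  π⁻¹ * ∫ θ in (0 : ℝ)..π, (2 * sin (θ / 2)) ^ a * cos (m * θ)

open Real in
lemma continuous_two_mul_sin_half_rpow {a : ℝ} (ha : 0 ≤ a) :
    Continuous fun θ : ℝ => (2 * sin (θ / 2)) ^ a :=
  (by fun_prop : Continuous fun θ : ℝ => 2 * sin (θ / 2)).rpow_const fun _ => Or.inr ha

-- The function `(2 sin(θ/2))^a (sin((m+1)θ) - sin(mθ))` vanishes at both `0` and `π`, so its
-- derivative integrates to zero; that derivative is the combination of the two integrands in `key`.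
open Real in
lemma rieszCoeff_succ {a : ℝ} (ha : 0 ≤ a) (m : ℕ) :
    (m + 1 + a / 2) * rieszCoeff a (m + 1) = (m - a / 2) * rieszCoeff a m := by
  have hg := continuous_two_mul_sin_half_rpow ha
  have hint : ∀ j : ℕ, IntervalIntegrable
      (fun θ : ℝ => (2 * sin (θ / 2)) ^ a * cos (j * θ)) volume 0 π := fun j =>
    (hg.mul (by fun_prop)).intervalIntegrable _ _
  have key : ∫ θ in (0 : ℝ)..π, ((m + 1 + a / 2) * ((2 * sin (θ / 2)) ^ a * cos ((m + 1 : ℕ) * θ))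
      - (m - a / 2) * ((2 * sin (θ / 2)) ^ a * cos (m * θ))) = 0 := by
    rw [intervalIntegral.integral_eq_sub_of_hasDerivAt_of_le (f := fun θ =>
      (2 * sin (θ / 2)) ^ a * (sin ((m + 1 : ℕ) * θ) - sin (m * θ))) pi_pos.le]
    · rw [sin_nat_mul_pi, sin_nat_mul_pi]
      simp
    · exact (hg.mul (by fun_prop)).continuousOn
    · intro θ hθ
      have hs : 0 < 2 * sin (θ / 2) := by
        have := sin_pos_of_pos_of_lt_pi (x := θ / 2) (by linarith [hθ.1]) (by linarith [hθ.1, hθ.2])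
        linarith
      have h1 : HasDerivAt (fun θ : ℝ => 2 * sin (θ / 2)) (cos (θ / 2)) θ := by
        have := ((hasDerivAt_id θ).div_const 2).sin.const_mul 2
        exact this.congr_deriv (by simp only [id]; ring)
      have h2 := h1.rpow_const (p := a) (Or.inl hs.ne')
      have h3 : ∀ c : ℝ, HasDerivAt (fun θ : ℝ => sin (c * θ)) (cos (c * θ) * c) θ := fun c => by
        simpa using ((hasDerivAt_id θ).const_mul c).sin
      refine (h2.mul ((h3 (m + 1 : ℕ)).sub (h3 m))).congr_deriv ?_
      rw [Pi.sub_apply]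
      -- Centring both angles at `(m + 1/2)θ` turns the derivative identity into a polynomial one in
      -- the sines and cosines of `(m + 1/2)θ` and `θ/2`.
      have e1 : ((m + 1 : ℕ) : ℝ) * θ = (m + 1 / 2) * θ + θ / 2 := by push_cast; ring
      have e2 : (m : ℝ) * θ = (m + 1 / 2) * θ - θ / 2 := by ring
      have e3 : (2 * sin (θ / 2)) ^ a = (2 * sin (θ / 2)) ^ (a - 1) * (2 * sin (θ / 2)) := by
        rw [← rpow_add_one hs.ne']; simp
      rw [e1, e2, e3, sin_add, sin_sub, cos_add, cos_sub]
      push_cast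
      ring
    · exact ((hint _).const_mul _).sub ((hint _).const_mul _)
  rw [intervalIntegral.integral_sub ((hint _).const_mul _) ((hint _).const_mul _),
    intervalIntegral.integral_const_mul, intervalIntegral.integral_const_mul] at key
  unfold rieszCoeff
  linear_combination π⁻¹ * key

open Real in
lemma rieszCoeff_zero_pos {a : ℝ} (ha : 0 ≤ a) : 0 < rieszCoeff a 0 := by
  refine mul_pos (inv_pos.2 pi_pos) ?_
  refine intervalIntegral.intervalIntegral_pos_of_pos_on
    (((continuous_two_mul_sin_half_rpow ha).mul (by fun_prop)).intervalIntegrable _ _) ?_ pi_pos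
  intro θ hθ
  have := sin_pos_of_pos_of_lt_pi (x := θ / 2) (by linarith [hθ.1]) (by linarith [hθ.1, hθ.2])
  simp only [Nat.cast_zero, zero_mul, cos_zero, mul_one]
  positivity

lemma rieszCoeff_succ_neg {a : ℝ} (ha : 0 < a) (ha2 : a < 2) (m : ℕ) :
    rieszCoeff a (m + 1) < 0 := by
  induction m with
  | zero =>
    have h := rieszCoeff_succ ha.le 0
    have h0 := rieszCoeff_zero_pos ha.le
    norm_num at h ⊢
    by_contra! hc
    nlinarith [mul_pos ha h0, mul_nonneg (by linarith : 0 ≤ 1 + a / 2) hc]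
  | succ m ih =>
    have h := rieszCoeff_succ ha.le (m + 1)
    push_cast at h
    have hm : (0 : ℝ) ≤ m := m.cast_nonneg
    have h1 : ((m : ℝ) + 1 - a / 2) * rieszCoeff a (m + 1) < 0 :=
      mul_neg_of_pos_of_neg (by linarith) ih
    by_contra! hc
    have := mul_nonneg (by linarith : 0 ≤ (m : ℝ) + 1 + 1 + a / 2) hc
    linarith

lemma rieszCoeff_neg {a : ℝ} (ha : 0 < a) (ha2 : a < 2) {m : ℕ} (hm : 1 ≤ m) :
    rieszCoeff a m < 0 := by
  obtain ⟨m, rfl⟩ := Nat.exists_eq_add_of_le' hm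
  exact rieszCoeff_succ_neg ha ha2 m

/-- For `j ≥ 1` the ratio `(j - a/2)/(j + 1 + a/2)` of consecutive coefficients lies in `(0, 1)`, so
the negative values move towards zero. -/
lemma rieszCoeff_mono {a : ℝ} (ha : 0 < a) (ha2 : a < 2) {m m' : ℕ} (hm : 1 ≤ m) (h : m ≤ m') :
    rieszCoeff a m ≤ rieszCoeff a m' := by
  induction m', h using Nat.le_induction with
  | base => rfl
  | succ j hj ih =>
    refine ih.trans ?_
    have h := rieszCoeff_succ ha.le j
    have h0 : (0 : ℝ) ≤ j := j.cast_nonneg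
    have h1 := rieszCoeff_neg ha ha2 (hm.trans hj)
    by_contra! hc
    nlinarith

/-- The recurrence makes the partial sums of the Fourier series at `θ = 0` telescope. -/
lemma rieszCoeff_zero_add_sum {a : ℝ} (ha : 0 < a) (N : ℕ) :
    rieszCoeff a 0 + 2 * ∑ m ∈ Finset.range N, rieszCoeff a (m + 1)
      = -(2 / a) * (N - a / 2) * rieszCoeff a N := by
  induction N with
  | zero => simp; field_simp
  | succ N ih =>
    rw [Finset.sum_range_succ, mul_add, ← add_assoc, ih]
    have h := rieszCoeff_succ ha.le N
    push_cast
    field_simp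
    linear_combination 2 * h

lemma two_mul_sum_neg_rieszCoeff_lt {a : ℝ} (ha : 0 < a) (ha2 : a < 2) (N : ℕ) :
    2 * ∑ m ∈ Finset.Ico 1 N, -rieszCoeff a m < rieszCoeff a 0 := by
  obtain _ | N := N
  · simpa using rieszCoeff_zero_pos ha.le
  have h1 := rieszCoeff_zero_add_sum ha N
  -- Passing from index `N` to `N + 1` makes the sign uniform: at `N = 0` both `N - a/2` and `t_N`
  -- have the opposite sign to the other cases.
  have h2 : -(2 / a) * (N - a / 2) * rieszCoeff a N
      = -(2 / a) * ((N + 1 + a / 2) * rieszCoeff a (N + 1)) := by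
    rw [rieszCoeff_succ ha.le]; ring
  have h3 : 0 < -(2 / a) * ((N + 1 + a / 2) * rieszCoeff a (N + 1)) :=
    mul_pos_of_neg_of_neg (by simp; positivity)
      (mul_neg_of_pos_of_neg (by positivity) (rieszCoeff_succ_neg ha ha2 N))
  rw [Finset.sum_Ico_eq_sum_range, Finset.sum_neg_distrib]
  simp only [add_tsub_cancel_right, add_comm 1]
  linarith

/-! ### Diagonal dominance of the unilevel matrices `T + cH`. -/

/-- The unilevel Toeplitz matrix of `|2 sin (θ / 2)| ^ a`. -/
noncomputable def rieszToeplitz (a : ℝ) (n : ℕ) : Matrix (Fin n) (Fin n) ℝ :=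
  Matrix.of fun i j => rieszCoeff a (Nat.dist i j)

/-- The unilevel Hankel correction of `rieszToeplitz`. -/
noncomputable def rieszHankel (a : ℝ) (n : ℕ) : Matrix (Fin n) (Fin n) ℝ :=
  Matrix.of fun i j =>
    if (i : ℕ) + j + 3 ≤ n then rieszCoeff a (i + j + 2)
    else if n + 1 ≤ (i : ℕ) + j then rieszCoeff a (2 * n - (i + j))
    else 0

lemma rieszHankel_nonpos {a : ℝ} (ha : 0 < a) (ha2 : a < 2) {n : ℕ} (i j : Fin n) :
    rieszHankel a n i j ≤ 0 := by
  simp only [rieszHankel, Matrix.of_apply]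
  split_ifs
  · exact (rieszCoeff_neg ha ha2 (by omega)).le
  · exact (rieszCoeff_neg ha ha2 (by omega)).le
  · rfl

lemma rieszToeplitz_nonpos {a : ℝ} (ha : 0 < a) (ha2 : a < 2) {n : ℕ} {i j : Fin n} (h : i ≠ j) :
    rieszToeplitz a n i j ≤ 0 := by
  have : (i : ℕ) ≠ j := fun e => h (Fin.ext e)
  exact (rieszCoeff_neg ha ha2 (by unfold Nat.dist; omega)).le

/-- Off the diagonal, the Hankel index `i + j + 2` or `2n - (i + j)` is at least `|i - j| ≥ 1`, so
monotonicity of the coefficients applies. -/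
lemma rieszToeplitz_le_rieszHankel {a : ℝ} (ha : 0 < a) (ha2 : a < 2) {n : ℕ} {i j : Fin n}
    (h : i ≠ j) : rieszToeplitz a n i j ≤ rieszHankel a n i j := by
  have hne : (i : ℕ) ≠ j := fun e => h (Fin.ext e)
  have h0 := rieszToeplitz_nonpos ha ha2 h
  simp only [rieszHankel, rieszToeplitz, Matrix.of_apply] at h0 ⊢
  split_ifs
  · exact rieszCoeff_mono ha ha2 (by unfold Nat.dist; omega) (by unfold Nat.dist; omega)
  · exact rieszCoeff_mono ha ha2 (by unfold Nat.dist; omega) (by unfold Nat.dist; omega)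
  · exact h0

/-- Each row of `|T| + |H|`, without the diagonal of `T`, has a sum at most `2 ∑_{1 ≤ m < n} u m`. -/
lemma row_sum_le_two_mul_sum {u : ℕ → ℝ} (hu : ∀ m, 1 ≤ m → 0 ≤ u m) {n : ℕ} (i : Fin n) :
    ∑ j : Fin n, ((if i = j then 0 else u (Nat.dist i j)) +
      (if (i : ℕ) + j + 3 ≤ n then u (i + j + 2)
        else if n + 1 ≤ (i : ℕ) + j then u (2 * n - (i + j)) else 0))
      ≤ 2 * ∑ m ∈ Finset.Ico 1 n, u m := by
  have hi := i.2
  have hsub : ∀ s : Finset ℕ, s ⊆ Finset.range n → ∀ e : ℕ → ℕ, Set.InjOn e s →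
      ∀ w : Finset ℕ, s.image e = w → ∑ j : Fin n, (if (j : ℕ) ∈ s then u (e j) else 0)
        = ∑ m ∈ w, u m := by
    intro s hs e he w hw
    rw [Fin.sum_univ_eq_sum_range (fun j => if j ∈ s then u (e j) else 0) n, ← hw,
      Finset.sum_image he, Finset.sum_ite_mem, Finset.inter_eq_right.2 hs]
  -- `hA` and `hB` treat `T` left and right of the diagonal, `hC` and `hD` the upper-left and
  -- lower-right corners of `H`; each piece runs injectively through an interval of indices.
  have hA := hsub (Finset.range i) (by intro x; simp; omega) (fun j => i - j)
    (by intro x hx y hy h; simp at *; omega) (Finset.Ico 1 (i + 1))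
    (by
      ext x; simp only [Finset.mem_image, Finset.mem_range, Finset.mem_Ico]
      exact ⟨by rintro ⟨y, hy, rfl⟩; omega, fun h => ⟨i - x, by omega, by omega⟩⟩)
  have hB := hsub (Finset.Ico (i + 1) n) (by intro x; simp) (fun j => j - i)
    (by intro x hx y hy h; simp at *; omega) (Finset.Ico 1 (n - i))
    (by
      ext x; simp only [Finset.mem_image, Finset.mem_Ico]
      exact ⟨by rintro ⟨y, hy, rfl⟩; omega, fun h => ⟨i + x, by omega, by omega⟩⟩)
  have hC := hsub (Finset.range (n - 2 - i)) (by intro x; simp; omega) (fun j => i + j + 2)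
    (by intro x hx y hy h; simp at *; omega) (Finset.Ico (i + 2) n)
    (by
      ext x; simp only [Finset.mem_image, Finset.mem_range, Finset.mem_Ico]
      exact ⟨by rintro ⟨y, hy, rfl⟩; omega, fun h => ⟨x - i - 2, by omega, by omega⟩⟩)
  have hD := hsub (Finset.Ico (n + 1 - i) n) (by intro x; simp) (fun j => 2 * n - (i + j))
    (by intro x hx y hy h; simp at *; omega) (Finset.Ico (n + 1 - i) n)
    (by
      ext x; simp only [Finset.mem_image, Finset.mem_Ico]
      exact ⟨by rintro ⟨y, hy, rfl⟩; omega, fun h => ⟨2 * n - i - x, by omega, by omega⟩⟩)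
  have hsum : ∑ j : Fin n, ((if i = j then 0 else u (Nat.dist i j)) +
      (if (i : ℕ) + j + 3 ≤ n then u (i + j + 2)
        else if n + 1 ≤ (i : ℕ) + j then u (2 * n - (i + j)) else 0))
      = (∑ m ∈ Finset.Ico 1 ((i : ℕ) + 1), u m + ∑ m ∈ Finset.Ico ((i : ℕ) + 2) n, u m) +
        (∑ m ∈ Finset.Ico 1 (n - i), u m + ∑ m ∈ Finset.Ico (n + 1 - i) n, u m) := by
    rw [← hA, ← hB, ← hC, ← hD, ← Finset.sum_add_distrib, ← Finset.sum_add_distrib,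
      ← Finset.sum_add_distrib]
    refine Finset.sum_congr rfl fun j _ => ?_
    have hj := j.2
    simp only [Finset.mem_range, Finset.mem_Ico, Fin.ext_iff]
    have e1 : (if (i : ℕ) = j then 0 else u (Nat.dist i j)) = (if (j : ℕ) < i then u (i - j) else 0)
        + (if (i : ℕ) + 1 ≤ j ∧ (j : ℕ) < n then u (j - i) else 0) := by
      rcases lt_trichotomy (i : ℕ) j with h | h | h
      · rw [if_neg h.ne, if_neg (by omega), if_pos (by omega), zero_add,
          Nat.dist_eq_sub_of_le h.le]
      · rw [if_pos h, if_neg (by omega), if_neg (by omega), zero_add]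
      · rw [if_neg h.ne', if_pos (by omega), if_neg (by omega), add_zero,
          Nat.dist_eq_sub_of_le_right h.le]
    have e2 : (if (i : ℕ) + j + 3 ≤ n then u (i + j + 2)
        else if n + 1 ≤ (i : ℕ) + j then u (2 * n - (i + j)) else 0)
        = (if (j : ℕ) < n - 2 - i then u (i + j + 2) else 0)
        + (if n + 1 - (i : ℕ) ≤ j ∧ (j : ℕ) < n then u (2 * n - (i + j)) else 0) := by
      by_cases h : (i : ℕ) + j + 3 ≤ n
      · rw [if_pos h, if_pos (by omega), if_neg (by omega), add_zero]
      · by_cases h' : n + 1 ≤ (i : ℕ) + j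
        · rw [if_neg h, if_pos h', if_neg (by omega), if_pos (by omega), zero_add]
        · rw [if_neg h, if_neg h', if_neg (by omega), if_neg (by omega), zero_add]
    rw [e1, e2]
    ring
  have hdis : ∀ s t : Finset ℕ, Disjoint s t → s ⊆ Finset.Ico 1 n → t ⊆ Finset.Ico 1 n →
      ∑ m ∈ s, u m + ∑ m ∈ t, u m ≤ ∑ m ∈ Finset.Ico 1 n, u m := by
    intro s t hst hs ht
    rw [← Finset.sum_union hst]
    exact Finset.sum_le_sum_of_subset_of_nonneg (Finset.union_subset hs ht)
      fun m hm _ => hu m (Finset.mem_Ico.1 hm).1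
  rw [hsum, two_mul]
  -- The pairs are `{1..i}`, `{i+2..n-1}` and `{1..n-1-i}`, `{n+1-i..n-1}`; each is disjoint inside
  -- `{1..n-1}`, so no coefficient occurs more than twice.
  refine add_le_add (hdis _ _ ?_ ?_ ?_) (hdis _ _ ?_ ?_ ?_)
  · rw [Finset.disjoint_left]; intro x; simp only [Finset.mem_Ico]; omega
  · intro x; simp only [Finset.mem_Ico]; omega
  · intro x; simp only [Finset.mem_Ico]; omega
  · rw [Finset.disjoint_left]; intro x; simp only [Finset.mem_Ico]; omega
  · intro x; simp only [Finset.mem_Ico]; omega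
  · intro x; simp only [Finset.mem_Ico]; omega

/-- The margin of the diagonal dominance of `T + c H`. -/
noncomputable def rieszGap (a : ℝ) (n : ℕ) : ℝ :=
  rieszCoeff a 0 - 2 * ∑ m ∈ Finset.Ico 1 n, -rieszCoeff a m

lemma rieszGap_pos {a : ℝ} (ha : 0 < a) (ha2 : a < 2) (n : ℕ) : 0 < rieszGap a n :=
  sub_pos.2 (two_mul_sum_neg_rieszCoeff_lt ha ha2 n)

lemma sum_abs_rieszToeplitz_add_le {a : ℝ} (ha : 0 < a) (ha2 : a < 2) {n : ℕ} (i : Fin n) :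
    ∑ j ∈ Finset.univ.erase i, |rieszToeplitz a n i j| + ∑ j, |rieszHankel a n i j|
      ≤ rieszCoeff a 0 - rieszGap a n := by
  have h := row_sum_le_two_mul_sum (u := fun m => -rieszCoeff a m)
    (fun m hm => neg_nonneg.2 (rieszCoeff_neg ha ha2 hm).le) i
  rw [rieszGap, sub_sub_cancel]
  refine le_of_eq_of_le ?_ h
  rw [Finset.sum_add_distrib]
  congr 1
  · rw [← Finset.add_sum_erase _ _ (Finset.mem_univ i), if_pos rfl, zero_add]
    refine Finset.sum_congr rfl fun j hj => ?_
    have hij : i ≠ j := (Finset.ne_of_mem_erase hj).symm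
    rw [if_neg hij, abs_of_nonpos (rieszToeplitz_nonpos ha ha2 hij)]
    rfl
  · refine Finset.sum_congr rfl fun j _ => ?_
    rw [abs_of_nonpos (rieszHankel_nonpos ha ha2 i j)]
    simp only [rieszHankel, Matrix.of_apply]
    split_ifs <;> simp

/-- `T + c H` is strictly diagonally dominant for `-3 ≤ c ≤ 1`. -/
lemma rieszGap_le_diag_sub_sum {a : ℝ} (ha : 0 < a) (ha2 : a < 2) {n : ℕ} {c : ℝ} (hc : -3 ≤ c)
    (hc1 : c ≤ 1) (i : Fin n) :
    rieszGap a n ≤ (rieszToeplitz a n + c • rieszHankel a n) i i -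
      ∑ j ∈ Finset.univ.erase i, |(rieszToeplitz a n + c • rieszHankel a n) i j| := by
  have h := sum_abs_rieszToeplitz_add_le ha ha2 i
  rw [← Finset.add_sum_erase _ _ (Finset.mem_univ i)] at h
  have h1 : ∑ j ∈ Finset.univ.erase i, |(rieszToeplitz a n + c • rieszHankel a n) i j| ≤
      ∑ j ∈ Finset.univ.erase i, (|rieszToeplitz a n i j| + |rieszHankel a n i j|) := by
    refine Finset.sum_le_sum fun j hj => ?_
    have hij : i ≠ j := (Finset.ne_of_mem_erase hj).symm
    have h2 := rieszToeplitz_le_rieszHankel ha ha2 hij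
    have h3 := rieszHankel_nonpos ha ha2 i j
    rw [abs_of_nonpos h3, abs_of_nonpos (h2.trans h3)]
    simp only [Matrix.add_apply, Matrix.smul_apply, smul_eq_mul]
    -- With `T ≤ H ≤ 0` the bounds are `T + H ≤ T + cH ≤ -T - H`: the left one needs `c ≤ 1`, the
    -- right one `c ≥ -3`.
    exact abs_le.2 ⟨by nlinarith, by nlinarith⟩
  rw [Finset.sum_add_distrib] at h1
  have h2 : rieszToeplitz a n i i = rieszCoeff a 0 := by simp [rieszToeplitz, Nat.dist_self]
  have h3 := rieszHankel_nonpos ha ha2 i i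
  rw [abs_of_nonpos h3] at h
  simp only [Matrix.add_apply, Matrix.smul_apply, smul_eq_mul] at h1 ⊢
  nlinarith

lemma rieszToeplitz_isSymm (a : ℝ) (n : ℕ) : (rieszToeplitz a n).IsSymm := by
  ext i j
  simp [rieszToeplitz, Nat.dist_comm]

lemma rieszHankel_isSymm (a : ℝ) (n : ℕ) : (rieszHankel a n).IsSymm := by
  ext i j
  simp [rieszHankel, add_comm (i : ℕ)]

open Matrix

/-! ### Quadratic forms of diagonally dominant symmetric matrices. -/

section Gershgorin

variable {ι : Type*} [Fintype ι]

/-- A quantitative Gershgorin bound for real symmetric matrices. -/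
lemma le_dotProduct_mulVec_of_diag_dominant [DecidableEq ι] {S : Matrix ι ι ℝ} (hS : S.IsSymm) {δ : ℝ}
    (h : ∀ i, δ ≤ S i i - ∑ j ∈ Finset.univ.erase i, |S i j|) (y : ι → ℝ) :
    δ * ∑ i, y i ^ 2 ≤ y ⬝ᵥ S *ᵥ y := by
  set m : ι → ι → ℝ := fun i j => if i = j then 0 else |S i j| with hm
  have hsymm : ∀ i j, m i j = m j i := fun i j => by
    simp only [hm, eq_comm (a := i), hS.apply i j]
  have hrow : ∀ i, ∑ j, m i j = ∑ j ∈ Finset.univ.erase i, |S i j| := fun i => by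
    rw [← Finset.add_sum_erase _ _ (Finset.mem_univ i)]
    simp only [hm, if_true, zero_add]
    exact Finset.sum_congr rfl fun j hj => if_neg (Finset.ne_of_mem_erase hj).symm
  have hoff : ∀ i, y i * ∑ j, S i j * y j ≥
      S i i * y i ^ 2 - ∑ j, m i j * ((y i ^ 2 + y j ^ 2) / 2) := fun i => by
    rw [ge_iff_le, Finset.mul_sum,
      ← Finset.add_sum_erase _ (fun j => y i * (S i j * y j)) (Finset.mem_univ i),
      ← Finset.add_sum_erase _ (fun j => m i j * ((y i ^ 2 + y j ^ 2) / 2)) (Finset.mem_univ i)]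
    have : ∑ j ∈ Finset.univ.erase i, -(m i j * ((y i ^ 2 + y j ^ 2) / 2)) ≤
        ∑ j ∈ Finset.univ.erase i, y i * (S i j * y j) := by
      refine Finset.sum_le_sum fun j hj => ?_
      simp only [hm, if_neg (Finset.ne_of_mem_erase hj).symm]
      have h1 : |y i * (S i j * y j)| = |S i j| * |y i * y j| := by
        rw [← abs_mul]; ring_nf
      have h2 : |y i * y j| ≤ (y i ^ 2 + y j ^ 2) / 2 :=
        abs_le.2 ⟨by nlinarith [sq_nonneg (y i + y j)], by nlinarith [sq_nonneg (y i - y j)]⟩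
      have h3 := neg_abs_le (y i * (S i j * y j))
      have h4 := mul_le_mul_of_nonneg_left h2 (abs_nonneg (S i j))
      linarith
    rw [Finset.sum_neg_distrib] at this
    simp only [hm, if_true, zero_mul, zero_add] at this ⊢
    linarith
  -- Symmetry of `m` lets the `y j ^ 2` half of each off-diagonal bound be charged to row `j`, so
  -- that only absolute row sums remain.
  have hswap : ∑ i, ∑ j, m i j * ((y i ^ 2 + y j ^ 2) / 2) = ∑ i, (∑ j, m i j) * y i ^ 2 := by
    have e1 : ∑ i, ∑ j, m i j * y j ^ 2 = ∑ i, ∑ j, m i j * y i ^ 2 := by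
      rw [Finset.sum_comm]
      exact Finset.sum_congr rfl fun i _ => Finset.sum_congr rfl fun j _ => by rw [hsymm]
    have e2 : ∑ i, ∑ j, m i j * ((y i ^ 2 + y j ^ 2) / 2) =
        (∑ i, ∑ j, m i j * y i ^ 2 + ∑ i, ∑ j, m i j * y j ^ 2) / 2 := by
      rw [← Finset.sum_add_distrib, Finset.sum_div]
      refine Finset.sum_congr rfl fun i _ => ?_
      rw [← Finset.sum_add_distrib, Finset.sum_div]
      exact Finset.sum_congr rfl fun j _ => by ring
    rw [e2, e1, add_self_div_two]
    exact Finset.sum_congr rfl fun i _ => (Finset.sum_mul _ _ _).symm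
  calc δ * ∑ i, y i ^ 2 = ∑ i, δ * y i ^ 2 := Finset.mul_sum _ _ _
    _ ≤ ∑ i, (S i i * y i ^ 2 - (∑ j, m i j) * y i ^ 2) := by
        refine Finset.sum_le_sum fun i _ => ?_
        rw [hrow, ← sub_mul]
        exact mul_le_mul_of_nonneg_right (h i) (sq_nonneg _)
    _ = ∑ i, (S i i * y i ^ 2 - ∑ j, m i j * ((y i ^ 2 + y j ^ 2) / 2)) := by
        rw [Finset.sum_sub_distrib, Finset.sum_sub_distrib, hswap]
    _ ≤ ∑ i, y i * ∑ j, S i j * y j := Finset.sum_le_sum fun i _ => hoff i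
    _ = y ⬝ᵥ S *ᵥ y := rfl

/-- The value of the Hermitian form of a real symmetric matrix at a complex vector. -/
lemma star_dotProduct_map_ofReal_mulVec {S : Matrix ι ι ℝ} (hS : S.IsSymm) (x : ι → ℂ) :
    star x ⬝ᵥ S.map Complex.ofReal *ᵥ x =
      (((fun i => (x i).re) ⬝ᵥ S *ᵥ (fun i => (x i).re) +
        (fun i => (x i).im) ⬝ᵥ S *ᵥ (fun i => (x i).im) : ℝ) : ℂ) := by
  simp only [dotProduct, mulVec, Finset.mul_sum, Pi.star_apply, map_apply]
  rw [← Finset.sum_add_distrib]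
  simp_rw [← Finset.sum_add_distrib]
  apply Complex.ext
  · rw [Complex.ofReal_re, Complex.re_sum]
    refine Finset.sum_congr rfl fun i _ => ?_
    rw [Complex.re_sum]
    refine Finset.sum_congr rfl fun j _ => ?_
    simp [Complex.mul_re, Complex.mul_im]
  · rw [Complex.ofReal_im, Complex.im_sum]
    have e : ∀ i, (∑ j, star (x i) * ((S i j : ℂ) * x j)).im =
        ∑ j, S i j * ((x i).re * (x j).im) - ∑ j, S i j * ((x i).im * (x j).re) := fun i => by
      rw [Complex.im_sum, ← Finset.sum_sub_distrib]
      refine Finset.sum_congr rfl fun j _ => ?_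
      simp [Complex.mul_re, Complex.mul_im]
      ring
    simp_rw [e]
    rw [Finset.sum_sub_distrib, sub_eq_zero, Finset.sum_comm]
    refine Finset.sum_congr rfl fun i _ => Finset.sum_congr rfl fun j _ => ?_
    rw [hS.apply i j]
    ring

end Gershgorin

/-! ### Weighted Kronecker sums and their dominance gaps. -/

section KroneckerSum

variable {k : ℕ} {n : Fin k → ℕ}

/-- The weighted Kronecker sum `∑ r, l r • (1 ⊗ ⋯ ⊗ M r ⊗ ⋯ ⊗ 1)`. -/
def kronSum (l : Fin k → ℝ) (M : ∀ r, Matrix (Fin (n r)) (Fin (n r)) ℝ) :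
    Matrix (∀ r, Fin (n r)) (∀ r, Fin (n r)) ℝ :=
  Matrix.of fun i j => ∑ r, l r * ∏ s, if s = r then M s (i s) (j s) else if i s = j s then 1 else 0

lemma kronSum_apply (l : Fin k → ℝ) (M : ∀ r, Matrix (Fin (n r)) (Fin (n r)) ℝ)
    (i j : ∀ r, Fin (n r)) :
    kronSum l M i j = ∑ r, l r * (M r (i r) (j r) *
      if ∀ s, s ≠ r → i s = j s then 1 else 0) := by
  rw [kronSum, Matrix.of_apply]
  refine Finset.sum_congr rfl fun r _ => ?_
  rw [← Finset.mul_prod_erase _ _ (Finset.mem_univ r), if_pos rfl]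
  congr 2
  have e : ∀ s ∈ Finset.univ.erase r, (if s = r then M s (i s) (j s) else
      if i s = j s then (1 : ℝ) else 0) = if i s = j s then 1 else 0 := fun s hs =>
    if_neg (Finset.ne_of_mem_erase hs)
  rw [Finset.prod_congr rfl e, Finset.prod_ite_zero]
  simp

lemma kronSum_add (l : Fin k → ℝ) (M N : ∀ r, Matrix (Fin (n r)) (Fin (n r)) ℝ) :
    kronSum l (fun r => M r + N r) = kronSum l M + kronSum l N := by
  ext i j
  simp only [kronSum_apply, Matrix.add_apply, ← Finset.sum_add_distrib]
  exact Finset.sum_congr rfl fun r _ => by ring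

lemma kronSum_smul (l : Fin k → ℝ) (c : ℝ) (M : ∀ r, Matrix (Fin (n r)) (Fin (n r)) ℝ) :
    kronSum l (fun r => c • M r) = c • kronSum l M := by
  ext i j
  simp only [kronSum_apply, Matrix.smul_apply, smul_eq_mul, Finset.mul_sum]
  exact Finset.sum_congr rfl fun r _ => by ring

lemma kronSum_isSymm (l : Fin k → ℝ) {M : ∀ r, Matrix (Fin (n r)) (Fin (n r)) ℝ}
    (hM : ∀ r, (M r).IsSymm) : (kronSum l M).IsSymm := by
  ext i j
  simp only [transpose_apply, kronSum_apply, fun r => (hM r).apply (i r) (j r),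
    fun s => @eq_comm _ (j s) (i s)]

/-- Summing over the multi-indices that agree with `i` off level `r` is summing over level `r`. -/
lemma sum_ite_eq_off (i : ∀ r, Fin (n r)) (r : Fin k) (f : Fin (n r) → ℝ) :
    ∑ j : ∀ r, Fin (n r), f (j r) * (if ∀ s, s ≠ r → i s = j s then 1 else 0) = ∑ b, f b := by
  simp only [mul_ite, mul_one, mul_zero]
  rw [← Finset.sum_filter]
  refine Finset.sum_nbij' (fun j => j r) (fun b => Function.update i r b) (by simp) ?_ ?_ (by simp)
    (by simp)
  · intro b _
    simp only [Finset.mem_filter, Finset.mem_univ, true_and]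
    intro s hs
    rw [Function.update_of_ne hs]
  · intro j hj
    simp only [Finset.mem_filter, Finset.mem_univ, true_and] at hj
    ext s
    by_cases hs : s = r
    · subst hs; simp
    · rw [Function.update_of_ne hs, hj s hs]

/-- The diagonal dominance gaps of the summands add up in a Kronecker sum. -/
lemma gap_kronSum {l : Fin k → ℝ} (hl : ∀ r, 0 ≤ l r)
    {M : ∀ r, Matrix (Fin (n r)) (Fin (n r)) ℝ} {δ : Fin k → ℝ}
    (h : ∀ r a, δ r ≤ M r a a - ∑ b ∈ Finset.univ.erase a, |M r a b|) (i : ∀ r, Fin (n r)) :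
    ∑ r, l r * δ r ≤ kronSum l M i i - ∑ j ∈ Finset.univ.erase i, |kronSum l M i j| := by
  have hdiag : kronSum l M i i = ∑ r, l r * M r (i r) (i r) := by simp [kronSum_apply]
  have hoff : ∑ j ∈ Finset.univ.erase i, |kronSum l M i j| ≤
      ∑ r, l r * ∑ b ∈ Finset.univ.erase (i r), |M r (i r) b| := by
    calc ∑ j ∈ Finset.univ.erase i, |kronSum l M i j|
        ≤ ∑ j ∈ Finset.univ.erase i, ∑ r, l r * (|M r (i r) (j r)| *
          if ∀ s, s ≠ r → i s = j s then 1 else 0) := by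
          refine Finset.sum_le_sum fun j _ => ?_
          rw [kronSum_apply]
          refine (Finset.abs_sum_le_sum_abs _ _).trans (le_of_eq ?_)
          refine Finset.sum_congr rfl fun r _ => ?_
          rw [abs_mul, abs_mul, abs_of_nonneg (hl r)]
          split_ifs <;> simp
      _ = ∑ r, l r * ∑ j ∈ Finset.univ.erase i, (|M r (i r) (j r)| *
          if ∀ s, s ≠ r → i s = j s then 1 else 0) := by
          rw [Finset.sum_comm]
          simp_rw [Finset.mul_sum]
      _ = ∑ r, l r * ∑ b ∈ Finset.univ.erase (i r), |M r (i r) b| := by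
          refine Finset.sum_congr rfl fun r _ => ?_
          have h1 := sum_ite_eq_off i r fun b => |M r (i r) b|
          rw [← Finset.add_sum_erase _ _ (Finset.mem_univ i),
            ← Finset.add_sum_erase _ _ (Finset.mem_univ (i r))] at h1
          simp only [implies_true, if_true, mul_one] at h1
          rw [add_left_cancel h1]
  have : ∑ r, l r * δ r ≤ ∑ r, (l r * M r (i r) (i r) -
      l r * ∑ b ∈ Finset.univ.erase (i r), |M r (i r) b|) := by
    refine Finset.sum_le_sum fun r _ => ?_
    rw [← mul_sub]
    exact mul_le_mul_of_nonneg_left (h r (i r)) (hl r)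
  rw [Finset.sum_sub_distrib] at this
  rw [hdiag]
  linarith

end KroneckerSum

/-! ### The `τ` operator on Kronecker sums. -/

section Tau

/-- Linearity of `τ`: every entry reads `t` only at indices below `n`, which the sum covers. -/
lemma sum_mul_tauUnilevel_single {n : ℕ} (t : ℕ → ℂ) (i j : Fin n) :
    ∑ a : Fin n, t a * tauUnilevel n (Pi.single (a : ℕ) 1) i j = tauUnilevel n t i j := by
  have hs : ∀ m < n, ∑ a : Fin n, t a * (Pi.single (a : ℕ) 1 : ℕ → ℂ) m = t m := fun m hm => by
    rw [Finset.sum_eq_single ⟨m, hm⟩]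
    · simp
    · intro b _ hb
      rw [Pi.single_eq_of_ne (fun e => hb (Fin.ext e.symm)), mul_zero]
    · simp
  have hi := i.2
  have hj := j.2
  simp only [tauUnilevel, Matrix.sub_apply, mul_sub, Finset.sum_sub_distrib, symToeplitz,
    hankelCorrection, Matrix.of_apply]
  congr 1
  · exact hs _ (by unfold Nat.dist; omega)
  · split_ifs
    · exact hs _ (by omega)
    · exact hs _ (by omega)
    · simp

/-- `τ` fixes the identity, because the Hankel part never reads `t 0`: its indices are all at least
`2`. -/
lemma tauUnilevel_single_zero {n : ℕ} (i j : Fin n) :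
    tauUnilevel n (Pi.single 0 1) i j = if i = j then 1 else 0 := by
  have hi := i.2
  have hj := j.2
  simp only [tauUnilevel, Matrix.sub_apply, symToeplitz, hankelCorrection, Matrix.of_apply,
    Pi.single_apply]
  have h1 : Nat.dist i j = 0 ↔ i = j := by rw [Fin.ext_iff]; unfold Nat.dist; omega
  simp only [h1]
  rw [if_neg (show ¬ (i : ℕ) + j + 2 = 0 by omega)]
  rw [show (if (i : ℕ) + j + 3 ≤ n then (0 : ℂ) else if n + 1 ≤ (i : ℕ) + j then
    if 2 * n - ((i : ℕ) + j) = 0 then 1 else 0 else 0) = 0 by split_ifs <;> first | rfl | omega,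
    sub_zero]

lemma tauUnilevel_rieszCoeff (a : ℝ) {n : ℕ} (i j : Fin n) :
    tauUnilevel n (fun m => (rieszCoeff a m : ℂ)) i j =
      (((rieszToeplitz a n + (-1 : ℝ) • rieszHankel a n) i j : ℝ) : ℂ) := by
  simp only [tauUnilevel, Matrix.sub_apply, symToeplitz, hankelCorrection, Matrix.of_apply,
    Matrix.add_apply, Matrix.smul_apply, rieszToeplitz, rieszHankel]
  split_ifs <;> simp [sub_eq_add_neg]

lemma tau_kronSum_rieszToeplitz {k : ℕ} (n : Fin k → ℕ) [∀ r, NeZero (n r)] (l α : Fin k → ℝ) :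
    tau n ((kronSum l fun r => rieszToeplitz (α r) (n r)).map Complex.ofReal) =
      (kronSum l fun r => rieszToeplitz (α r) (n r) + (-1 : ℝ) • rieszHankel (α r) (n r)).map
        Complex.ofReal := by
  ext i j
  simp only [tau, Matrix.of_apply, Matrix.map_apply, kronSum]
  push_cast
  simp_rw [Finset.sum_mul]
  rw [Finset.sum_comm]
  refine Finset.sum_congr rfl fun r _ => ?_
  simp_rw [mul_assoc, ← Finset.prod_mul_distrib, ← Finset.mul_sum]
  congr 1
  -- The sum over multi-indices of a product over levels is the product of the unilevel sums, so
  -- each level can be treated alone.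
  rw [← Fintype.piFinset_univ, ← Finset.prod_univ_sum (fun s => (Finset.univ : Finset (Fin (n s))))
    (fun s (a : Fin (n s)) => ((if s = r then rieszToeplitz (α s) (n s) 0 a else
      if 0 = a then 1 else 0 : ℝ) : ℂ) * tauUnilevel (n s) (Pi.single (a : ℕ) 1) (i s) (j s))]
  refine Finset.prod_congr rfl fun s _ => ?_
  split_ifs with h h'
  · rw [← tauUnilevel_rieszCoeff, ← sum_mul_tauUnilevel_single]
    simp [rieszToeplitz, Nat.dist]
  all_goals
    rw [Finset.sum_eq_single 0 (fun b _ hb => by rw [if_neg hb.symm]; simp) (by simp)]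
    simp [tauUnilevel_single_zero, h']

end Tau

lemma isCompact_cube (k : ℕ) : IsCompact (cube k) := isCompact_Icc

lemma volume_restrict_cube (k : ℕ) : (volume : Measure (Fin k → ℝ)).restrict (cube k) =
    Measure.pi fun _ => (volume : Measure ℝ).restrict (Set.Icc (-Real.pi) Real.pi) := by
  rw [cube, ← Set.pi_univ_Icc, volume_pi, Measure.restrict_pi_pi]

/-! ### The Toeplitz matrix of `r` as a Kronecker sum. -/

section FourierCoefficient

open Real in
/-- The Fourier integrals of an even function are cosine integrals. -/
lemma integral_even_mul_exp {f : ℝ → ℝ} (hf : Continuous f) (heven : ∀ θ, f (-θ) = f θ) (j : ℤ) :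
    ∫ θ in Set.Icc (-π) π, (f θ : ℂ) * Complex.exp (Complex.I * (((j : ℝ) * θ : ℝ) : ℂ)) =
      ((2 * ∫ θ in (0 : ℝ)..π, f θ * cos (j.natAbs * θ) : ℝ) : ℂ) := by
  set F : ℝ → ℂ := fun θ => (f θ : ℂ) * Complex.exp (Complex.I * (((j : ℝ) * θ : ℝ) : ℂ)) with hF
  have hFc : Continuous F := by fun_prop
  have hint : ∀ a b, IntervalIntegrable F volume a b := fun a b => hFc.intervalIntegrable a b
  have hint' : IntervalIntegrable (fun θ => F (-θ)) volume 0 π :=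
    (hFc.comp continuous_neg).intervalIntegrable _ _
  have hneg : ∫ θ in (-π)..0, F θ = ∫ θ in (0 : ℝ)..π, F (-θ) := by
    rw [intervalIntegral.integral_comp_neg, neg_zero]
  rw [integral_Icc_eq_integral_Ioc, ← intervalIntegral.integral_of_le (by linarith [pi_pos]),
    ← intervalIntegral.integral_add_adjacent_intervals (hint (-π) 0) (hint 0 π), hneg,
    ← intervalIntegral.integral_add hint' (hint _ _),
    ← intervalIntegral.integral_const_mul, ← intervalIntegral.integral_ofReal]
  refine intervalIntegral.integral_congr fun θ _ => ?_
  have hcos : cos (j.natAbs * θ) = cos (j * θ) := by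
    rcases Int.natAbs_eq j with h | h
    · conv_rhs => rw [h]
      simp
    · conv_rhs => rw [h]
      simp
  simp only [hF, heven, hcos]
  rw [mul_neg, Complex.ofReal_neg, mul_neg, mul_comm Complex.I, ← neg_mul]
  push_cast
  rw [Complex.cos]
  ring

open Real in
lemma integral_riesz_mul_exp {a : ℝ} (ha : 0 ≤ a) (j : ℤ) :
    ∫ θ in Set.Icc (-π) π, ((|2 * sin (θ / 2)| ^ a : ℝ) : ℂ) *
      Complex.exp (Complex.I * (((j : ℝ) * θ : ℝ) : ℂ)) =
      ((2 * π * rieszCoeff a j.natAbs : ℝ) : ℂ) := by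
  rw [integral_even_mul_exp
    ((by fun_prop : Continuous fun θ : ℝ => |2 * sin (θ / 2)|).rpow_const fun _ => Or.inr ha)
    (fun θ => by rw [neg_div, sin_neg, mul_neg, abs_neg]), rieszCoeff]
  have h : ∫ θ in (0 : ℝ)..π, |2 * sin (θ / 2)| ^ a * cos (j.natAbs * θ) =
      ∫ θ in (0 : ℝ)..π, (2 * sin (θ / 2)) ^ a * cos (j.natAbs * θ) := by
    refine intervalIntegral.integral_congr fun θ hθ => ?_
    rw [Set.uIcc_of_le pi_pos.le] at hθ
    have := sin_nonneg_of_nonneg_of_le_pi (x := θ / 2) (by linarith [hθ.1])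
      (by linarith [hθ.2, pi_pos])
    simp only [abs_of_nonneg (mul_nonneg zero_le_two this)]
  rw [h]
  congr 1
  have := pi_ne_zero
  generalize ∫ θ in (0 : ℝ)..π, (2 * sin (θ / 2)) ^ a * cos (j.natAbs * θ) = z
  field_simp

open Real in
lemma integral_exp_mul_int (j : ℤ) :
    ∫ θ in Set.Icc (-π) π, Complex.exp (Complex.I * (((j : ℝ) * θ : ℝ) : ℂ)) =
      ((2 * π * if j = 0 then 1 else 0 : ℝ) : ℂ) := by
  have h := integral_even_mul_exp (f := fun _ => 1) continuous_const (fun _ => rfl) j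
  simp only [Complex.ofReal_one, one_mul] at h
  rw [h]
  congr 1
  split_ifs with hj
  · simp [hj]
  · have hj' : (j.natAbs : ℝ) ≠ 0 := by exact_mod_cast Int.natAbs_ne_zero.2 hj
    rw [intervalIntegral.integral_comp_mul_left (fun x => cos x) hj', integral_cos,
      sin_nat_mul_pi]
    simp

open Real in
lemma continuous_abs_two_mul_sin_half_rpow {a : ℝ} (ha : 0 ≤ a) :
    Continuous fun θ : ℝ => |2 * sin (θ / 2)| ^ a :=
  (by fun_prop : Continuous fun θ : ℝ => |2 * sin (θ / 2)|).rpow_const fun _ => Or.inr ha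

lemma continuous_rFun {k : ℕ} {l α : Fin k → ℝ} (hα : ∀ i, 0 ≤ α i) : Continuous (rFun l α) := by
  unfold rFun
  exact continuous_finsetSum _ fun i _ => continuous_const.mul
    ((continuous_abs_two_mul_sin_half_rpow (hα i)).comp (continuous_apply i))

/-- Each summand of `r` depends on one variable, so its integral factorises: that level gives a
Riesz coefficient, and orthogonality of exponentials gives a Kronecker delta at all others. -/
lemma fourierCoefficient_rFun {k : ℕ} {l α : Fin k → ℝ} (hα : ∀ i, 0 ≤ α i) (j : Fin k → ℤ) :
    fourierCoefficient (rFun l α) j = ((∑ r, l r * ∏ s, if s = r then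
      rieszCoeff (α s) (j s).natAbs else if j s = 0 then 1 else 0 : ℝ) : ℂ) := by
  set G : Fin k → Fin k → ℝ → ℂ := fun r s t =>
    (if s = r then ((|2 * Real.sin (t / 2)| ^ α s : ℝ) : ℂ) else 1) *
      Complex.exp (Complex.I * (((j s : ℝ) * t : ℝ) : ℂ)) with hG
  have hGc : ∀ r s, Continuous (G r s) := fun r s => by
    refine Continuous.mul ?_ (by fun_prop)
    split_ifs
    · exact Complex.continuous_ofReal.comp (continuous_abs_two_mul_sin_half_rpow (hα s))
    · exact continuous_const
  have hGi : ∀ r s, ∫ t in Set.Icc (-Real.pi) Real.pi, G r s t = ((2 * Real.pi *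
      (if s = r then rieszCoeff (α s) (j s).natAbs else if j s = 0 then 1 else 0) : ℝ) : ℂ) := by
    intro r s
    by_cases h : s = r
    · simp only [hG, if_pos h]
      exact integral_riesz_mul_exp (hα s) (j s)
    · simp only [hG, if_neg h, one_mul]
      exact integral_exp_mul_int (j s)
  have hexp : ∀ θ : Fin k → ℝ, (rFun l α θ : ℂ) *
      Complex.exp (Complex.I * ((∑ t, (j t : ℝ) * θ t : ℝ) : ℂ)) =
      ∑ r, (l r : ℂ) * ∏ s, G r s (θ s) := fun θ => by
    simp only [hG, Finset.prod_mul_distrib, ← Complex.exp_sum, ← Finset.mul_sum, rFun]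
    push_cast
    rw [Finset.sum_mul]
    refine Finset.sum_congr rfl fun r _ => ?_
    rw [Finset.prod_ite_eq' Finset.univ r, if_pos (Finset.mem_univ r), mul_assoc]
  rw [fourierCoefficient]
  simp_rw [hexp]
  rw [integral_finsetSum _ fun r _ => ?_]
  · rw [Finset.mul_sum]
    push_cast
    refine Finset.sum_congr rfl fun r _ => ?_
    rw [integral_const_mul, volume_restrict_cube, integral_fintype_prod_eq_prod (G r)]
    simp_rw [hGi]
    push_cast
    rw [Finset.prod_mul_distrib, Finset.prod_const, Finset.card_univ, Fintype.card_fin]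
    have : (2 * (Real.pi : ℂ)) ^ k ≠ 0 := pow_ne_zero _ (by simp [Real.pi_ne_zero])
    field_simp
  · refine Continuous.integrableOn_Icc (continuous_const.mul ?_)
    exact continuous_finsetProd _ fun s _ => (hGc r s).comp (continuous_apply s)

lemma toeplitz_rFun {k : ℕ} (n : Fin k → ℕ) {l α : Fin k → ℝ} (hα : ∀ i, 0 ≤ α i) :
    toeplitz n (rFun l α) =
      (kronSum l fun r => rieszToeplitz (α r) (n r)).map Complex.ofReal := by
  ext i j
  rw [toeplitz, Matrix.of_apply, fourierCoefficient_rFun hα]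
  simp only [Matrix.map_apply, kronSum, Matrix.of_apply, rieszToeplitz]
  congr 1
  refine Finset.sum_congr rfl fun r _ => ?_
  congr 1
  refine Finset.prod_congr rfl fun s _ => ?_
  have h1 : (((i s : ℕ) : ℤ) - ((j s : ℕ) : ℤ)).natAbs = Nat.dist (i s) (j s) := by
    unfold Nat.dist; omega
  have h2 : (((i s : ℕ) : ℤ) - ((j s : ℕ) : ℤ)) = 0 ↔ i s = j s := by rw [Fin.ext_iff]; omega
  simp only [h1, h2]

end FourierCoefficient

/-! ### Toeplitz forms as integrals against the symbol. -/

section HermitianForm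

variable {k : ℕ} {n : Fin k → ℕ}

/-- The trigonometric polynomial with coefficient vector `x`. -/
noncomputable def trigPoly (x : (∀ r, Fin (n r)) → ℂ) (θ : Fin k → ℝ) : ℂ :=
  ∑ j, x j * Complex.exp (-(Complex.I * ((∑ t, ((j t : ℕ) : ℝ) * θ t : ℝ) : ℂ)))

lemma continuous_trigPoly (x : (∀ r, Fin (n r)) → ℂ) : Continuous (trigPoly x) := by
  unfold trigPoly
  fun_prop

lemma integrableOn_mul_normSq_trigPoly {f : (Fin k → ℝ) → ℝ} (hf : IntegrableOn f (cube k) volume)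
    (x : (∀ r, Fin (n r)) → ℂ) :
    IntegrableOn (fun θ => f θ * Complex.normSq (trigPoly x θ)) (cube k) volume :=
  hf.mul_continuousOn (Complex.continuous_normSq.comp (continuous_trigPoly x)).continuousOn
    (isCompact_cube k)

lemma star_dotProduct_toeplitz_mulVec {f : (Fin k → ℝ) → ℝ} (hf : IntegrableOn f (cube k) volume)
    (x : (∀ r, Fin (n r)) → ℂ) :
    star x ⬝ᵥ toeplitz n f *ᵥ x = ((((2 * Real.pi) ^ k)⁻¹ *
      ∫ θ in cube k, f θ * Complex.normSq (trigPoly x θ) : ℝ) : ℂ) := by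
  have hint : ∀ i j : ∀ r, Fin (n r), IntegrableOn (fun θ : Fin k → ℝ => star (x i) *
      ((f θ : ℂ) * Complex.exp (Complex.I * ((∑ t, (((((i t : ℕ) : ℤ) - ((j t : ℕ) : ℤ) : ℤ)) : ℝ)
        * θ t : ℝ) : ℂ))) * x j) (cube k) volume := fun i j => by
    refine ((Integrable.mul_const (Integrable.const_mul ?_ _) _))
    exact IntegrableOn.mul_continuousOn (Integrable.ofReal hf) (by fun_prop) (isCompact_cube k)
  have hpt : ∀ θ, ((f θ * Complex.normSq (trigPoly x θ) : ℝ) : ℂ) = ∑ i, ∑ j, star (x i) *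
      ((f θ : ℂ) * Complex.exp (Complex.I * ((∑ t, (((((i t : ℕ) : ℤ) - ((j t : ℕ) : ℤ) : ℤ)) : ℝ)
        * θ t : ℝ) : ℂ))) * x j := fun θ => by
    rw [Complex.ofReal_mul, Complex.normSq_eq_conj_mul_self, trigPoly, map_sum,
      Finset.sum_mul_sum, Finset.mul_sum]
    refine Finset.sum_congr rfl fun i _ => ?_
    rw [Finset.mul_sum]
    refine Finset.sum_congr rfl fun j _ => ?_
    rw [map_mul, ← Complex.exp_conj, map_neg, map_mul, Complex.conj_I, Complex.conj_ofReal]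
    have : Complex.exp (Complex.I * ((∑ t, (((((i t : ℕ) : ℤ) - ((j t : ℕ) : ℤ) : ℤ)) : ℝ)
        * θ t : ℝ) : ℂ)) = Complex.exp (-(-Complex.I * ((∑ t, ((i t : ℕ) : ℝ) * θ t : ℝ) : ℂ))) *
        Complex.exp (-(Complex.I * ((∑ t, ((j t : ℕ) : ℝ) * θ t : ℝ) : ℂ))) := by
      rw [← Complex.exp_add]
      congr 1
      push_cast
      simp only [sub_mul, Finset.sum_sub_distrib]
      ring
    rw [this, starRingEnd_apply]
    ring
  rw [Complex.ofReal_mul, ← integral_complex_ofReal]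
  simp_rw [hpt]
  rw [integral_finsetSum _ fun i _ => integrable_finsetSum _ fun j _ => hint i j]
  simp only [dotProduct, mulVec, Pi.star_apply, Finset.mul_sum]
  refine Finset.sum_congr rfl fun i _ => ?_
  rw [integral_finsetSum _ fun j _ => hint i j, Finset.mul_sum]
  refine Finset.sum_congr rfl fun j _ => ?_
  rw [integral_mul_const, integral_const_mul, toeplitz, Matrix.of_apply, fourierCoefficient]
  push_cast
  ring

end HermitianForm

/-! ### Comparison of `q` and `r`, from `(2/π)|x| ≤ |sin x| ≤ |x|` for `|x| ≤ π/2`. -/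

section SymbolComparison

variable {k : ℕ}

open Real in
lemma two_mul_abs_sin_half_le (t : ℝ) : |2 * sin (t / 2)| ≤ |t| := by
  rw [abs_mul, abs_two]
  have := abs_sin_le_abs (x := t / 2)
  rw [abs_div, abs_two] at this
  linarith

open Real in
lemma abs_le_mul_two_mul_abs_sin_half {t : ℝ} (ht : |t| ≤ π) :
    |t| ≤ π / 2 * |2 * sin (t / 2)| := by
  have h := mul_abs_le_abs_sin (x := t / 2) (by rw [abs_div, abs_two]; linarith)
  rw [abs_div, abs_two] at h
  rw [abs_mul, abs_two]
  have := pi_pos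
  field_simp at h ⊢
  linarith

lemma rFun_le_qFun {l α : Fin k → ℝ} (hl : ∀ i, 0 ≤ l i) (hα : ∀ i, 0 ≤ α i) (θ : Fin k → ℝ) :
    rFun l α θ ≤ qFun l α θ :=
  Finset.sum_le_sum fun i _ => mul_le_mul_of_nonneg_left
    (Real.rpow_le_rpow (abs_nonneg _) (two_mul_abs_sin_half_le _) (hα i)) (hl i)

lemma rFun_nonneg {l α : Fin k → ℝ} (hl : ∀ i, 0 ≤ l i) (θ : Fin k → ℝ) : 0 ≤ rFun l α θ :=
  Finset.sum_nonneg fun i _ => mul_nonneg (hl i) (Real.rpow_nonneg (abs_nonneg _) _)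

open Real in
lemma qFun_le_mul_rFun {l α : Fin k → ℝ} (hl : ∀ i, 0 ≤ l i) (hα : ∀ i, 0 ≤ α i)
    (hα2 : ∀ i, α i ≤ 2) {θ : Fin k → ℝ} (hθ : θ ∈ cube k) :
    qFun l α θ ≤ π ^ 2 / 4 * rFun l α θ := by
  rw [qFun, rFun, Finset.mul_sum]
  refine Finset.sum_le_sum fun i _ => ?_
  have ht : |θ i| ≤ π := abs_le.2 ⟨hθ.1 i, hθ.2 i⟩
  have h1 : |θ i| ^ α i ≤ (π / 2) ^ α i * |2 * sin (θ i / 2)| ^ α i := by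
    rw [← mul_rpow (by positivity) (abs_nonneg _)]
    exact rpow_le_rpow (abs_nonneg _) (abs_le_mul_two_mul_abs_sin_half ht) (hα i)
  -- Since `π/2 ≥ 1` and `α i ≤ 2`, the square is a bound common to all levels.
  have h2 : (π / 2) ^ α i ≤ π ^ 2 / 4 := by
    have := rpow_le_rpow_of_exponent_le (x := π / 2) (by linarith [two_le_pi]) (hα2 i)
    rw [rpow_two] at this
    linarith
  have h3 := mul_le_mul_of_nonneg_right h2 (rpow_nonneg (abs_nonneg (2 * sin (θ i / 2))) (α i))
  calc l i * |θ i| ^ α i ≤ l i * (π ^ 2 / 4 * |2 * sin (θ i / 2)| ^ α i) :=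
        mul_le_mul_of_nonneg_left (h1.trans h3) (hl i)
    _ = π ^ 2 / 4 * (l i * |2 * sin (θ i / 2)| ^ α i) := by ring

end SymbolComparison

lemma volume_cube_ne_zero (k : ℕ) : volume (cube k) ≠ 0 := by
  rw [cube, Real.volume_Icc_pi]
  refine Finset.prod_ne_zero_iff.2 fun i _ => ?_
  simp [Real.pi_pos]

/-! ### Comparison of the forms of `R` and `τ(R)`. -/

section KroneckerForm

variable {k : ℕ} {n : Fin k → ℕ}

/-- The forms `a`, `h` of the Kronecker sums of the Toeplitz matrices and of the Hankel corrections
satisfy `a + c h ≥ δ ‖x‖²` for `-3 ≤ c ≤ 1`. -/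
lemma exists_forms {α l : Fin k → ℝ} (hα : ∀ i, 0 < α i ∧ α i < 2) (hl : ∀ i, 0 ≤ l i)
    (x : (∀ r, Fin (n r)) → ℂ) :
    ∃ a h : ℝ, ∀ c : ℝ, star x ⬝ᵥ (kronSum l fun r => rieszToeplitz (α r) (n r) +
          c • rieszHankel (α r) (n r)).map Complex.ofReal *ᵥ x = ((a + c * h : ℝ) : ℂ) ∧
      (-3 ≤ c → c ≤ 1 →
        (∑ r, l r * rieszGap (α r) (n r)) * ∑ i, Complex.normSq (x i) ≤ a + c * h) := by
  set T := kronSum l fun r => rieszToeplitz (α r) (n r) with hT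
  set H := kronSum l fun r => rieszHankel (α r) (n r) with hH
  set u : (∀ r, Fin (n r)) → ℝ := fun i => (x i).re
  set v : (∀ r, Fin (n r)) → ℝ := fun i => (x i).im
  refine ⟨u ⬝ᵥ T *ᵥ u + v ⬝ᵥ T *ᵥ v, u ⬝ᵥ H *ᵥ u + v ⬝ᵥ H *ᵥ v, fun c => ?_⟩
  have hsymm : (kronSum l fun r => rieszToeplitz (α r) (n r) +
      c • rieszHankel (α r) (n r)).IsSymm :=
    kronSum_isSymm l fun r => (rieszToeplitz_isSymm _ _).add ((rieszHankel_isSymm _ _).smul c)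
  have hq : ∀ y : (∀ r, Fin (n r)) → ℝ, y ⬝ᵥ (kronSum l fun r => rieszToeplitz (α r) (n r) +
      c • rieszHankel (α r) (n r)) *ᵥ y = y ⬝ᵥ T *ᵥ y + c * (y ⬝ᵥ H *ᵥ y) := fun y => by
    rw [kronSum_add, kronSum_smul, add_mulVec, smul_mulVec, dotProduct_add, dotProduct_smul,
      smul_eq_mul]
  refine ⟨?_, fun hc hc1 => ?_⟩
  · rw [star_dotProduct_map_ofReal_mulVec hsymm, hq, hq]
    congr 1
    ring
  · have hb := fun y => le_dotProduct_mulVec_of_diag_dominant hsymm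
      (gap_kronSum hl fun r => rieszGap_le_diag_sub_sum (hα r).1 (hα r).2 hc hc1) y
    have h1 := hb u
    have h2 := hb v
    rw [hq] at h1 h2
    have h3 : ∑ i, Complex.normSq (x i) = ∑ i, u i ^ 2 + ∑ i, v i ^ 2 := by
      rw [← Finset.sum_add_distrib]
      exact Finset.sum_congr rfl fun i _ => by rw [Complex.normSq_apply]; ring
    rw [h3, mul_add]
    linarith

lemma sum_normSq_pos {ι : Type*} [Fintype ι] {x : ι → ℂ} (hx : x ≠ 0) :
    0 < ∑ i, Complex.normSq (x i) := by
  obtain ⟨i, hi⟩ := Function.ne_iff.1 hx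
  exact Finset.sum_pos' (fun i _ => Complex.normSq_nonneg _)
    ⟨i, Finset.mem_univ i, Complex.normSq_pos.2 hi⟩

/-- The form of `τ(R)` is positive definite, and `τ(R) / 2 ≤ R ≤ 3 τ(R) / 2`. -/
lemma exists_tau_form [∀ r, NeZero (n r)] {α l : Fin k → ℝ} (hk : k ≠ 0)
    (hα : ∀ i, 0 < α i ∧ α i < 2) (hl : ∀ i, 0 < l i) {x : (∀ r, Fin (n r)) → ℂ} (hx : x ≠ 0) :
    ∃ s a : ℝ, star x ⬝ᵥ tau n (toeplitz n (rFun l α)) *ᵥ x = s ∧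
      star x ⬝ᵥ toeplitz n (rFun l α) *ᵥ x = a ∧ 0 < s ∧ s / 2 ≤ a ∧ a ≤ 3 / 2 * s := by
  obtain ⟨a, h, hah⟩ := exists_forms (n := n) hα (fun i => (hl i).le) x
  have hR := toeplitz_rFun n (l := l) fun i => (hα i).1.le
  have hpos : 0 < (∑ r, l r * rieszGap (α r) (n r)) * ∑ i, Complex.normSq (x i) := by
    have : NeZero k := ⟨hk⟩
    exact mul_pos (Finset.sum_pos (fun r _ => mul_pos (hl r) (rieszGap_pos (hα r).1 (hα r).2 _))
      Finset.univ_nonempty) (sum_normSq_pos hx)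
  -- With `s = a - h`, the endpoint `c = -3` gives `a ≤ 3s/2` and `c = 1` gives `s/2 ≤ a`; since
  -- `-1` is their midpoint, `s > 0` follows as well.
  have h1 := (hah (-3)).2 le_rfl (by norm_num)
  have h2 := (hah 1).2 (by norm_num) le_rfl
  have h3 := (hah 0).1
  simp only [zero_smul, add_zero, zero_mul] at h3
  refine ⟨a + -1 * h, a, ?_, ?_, ?_, ?_, ?_⟩
  · rw [hR, tau_kronSum_rieszToeplitz, (hah (-1)).1]
  · rw [hR, h3]
  all_goals linarith

end KroneckerForm

/-- The forms of two Toeplitz matrices whose symbols are comparable are comparable. -/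
lemma exists_toeplitz_form {k : ℕ} {n : Fin k → ℕ} {f g : (Fin k → ℝ) → ℝ} {c d : ℝ}
    (hf : IntegrableOn f (cube k) volume) (hg : IntegrableOn g (cube k) volume)
    (h : ∀ᵐ θ ∂(volume.restrict (cube k)), c * g θ ≤ f θ ∧ f θ ≤ d * g θ)
    (x : (∀ r, Fin (n r)) → ℂ) {a : ℝ} (ha : star x ⬝ᵥ toeplitz n g *ᵥ x = a) :
    ∃ b : ℝ, star x ⬝ᵥ toeplitz n f *ᵥ x = b ∧ c * a ≤ b ∧ b ≤ d * a := by
  refine ⟨_, star_dotProduct_toeplitz_mulVec hf x, ?_⟩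
  rw [star_dotProduct_toeplitz_mulVec hg, Complex.ofReal_inj] at ha
  rw [← ha, mul_left_comm, mul_left_comm d, ← integral_const_mul c, ← integral_const_mul d]
  have hpi : 0 ≤ ((2 * Real.pi) ^ k)⁻¹ := by positivity
  have hfi := integrableOn_mul_normSq_trigPoly hf x
  have hgi := integrableOn_mul_normSq_trigPoly hg x
  refine ⟨mul_le_mul_of_nonneg_left ?_ hpi, mul_le_mul_of_nonneg_left ?_ hpi⟩
  · refine integral_mono_ae (hgi.const_mul c) hfi ?_
    filter_upwards [h] with θ hθ
    rw [← mul_assoc]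
    exact mul_le_mul_of_nonneg_right hθ.1 (Complex.normSq_nonneg _)
  · refine integral_mono_ae hfi (hgi.const_mul d) ?_
    filter_upwards [h] with θ hθ
    rw [← mul_assoc]
    exact mul_le_mul_of_nonneg_right hθ.2 (Complex.normSq_nonneg _)

/-- Bounds on `p / q` give bounds of `p` by multiples of `r`. -/
lemma rFun_bounds {k : ℕ} {α l : Fin k → ℝ} (hα : ∀ i, 0 ≤ α i ∧ α i ≤ 2) (hl : ∀ i, 0 ≤ l i)
    {θ : Fin k → ℝ} (hθ : θ ∈ cube k) {y c₀ c₁ : ℝ} (hc₀ : 0 < c₀) (h0 : c₀ ≤ y / qFun l α θ)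
    (h1 : y / qFun l α θ ≤ c₁) :
    c₀ * rFun l α θ ≤ y ∧ y ≤ c₁ * (Real.pi ^ 2 / 4) * rFun l α θ := by
  have hrq := rFun_le_qFun hl (fun i => (hα i).1) θ
  have hqr := qFun_le_mul_rFun hl (fun i => (hα i).1) (fun i => (hα i).2) hθ
  have hq : 0 < qFun l α θ := by
    refine lt_of_le_of_ne ((rFun_nonneg hl θ).trans hrq) fun e => ?_
    rw [← e, div_zero] at h0
    linarith
  rw [le_div_iff₀ hq] at h0
  rw [div_le_iff₀ hq] at h1
  refine ⟨(mul_le_mul_of_nonneg_left hrq hc₀.le).trans h0, h1.trans ?_⟩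
  rw [mul_assoc]
  refine mul_le_mul_of_nonneg_left hqr ?_
  -- A negative `c₁` would give `y ≤ c₁ q < 0 < c₀ q ≤ y`.
  by_contra! hc
  have := mul_pos hc₀ hq
  have := mul_neg_of_neg_of_pos hc hq
  linarith

end MultilevelToeplitz

/-! ### The eigenvalue bounds. -/

open MultilevelToeplitz Matrix in
theorem mainTheorem5 {k : ℕ} (α l : Fin k → ℝ)
    (hα : ∀ i, 1 < α i ∧ α i < 2) (hl : ∀ i, 0 < l i)
    (p : (Fin k → ℝ) → ℝ)
    (hp_int : IntegrableOn p (MultilevelToeplitz.cube k) volume)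
    (hp_even : ∀ᵐ θ ∂(volume.restrict (MultilevelToeplitz.cube k)), p (-θ) = p θ)
    (c₀ c₁ : ℝ) (hc₀ : 0 < c₀)
    (hpq : ∀ᵐ θ ∂(volume.restrict (MultilevelToeplitz.cube k)),
      c₀ ≤ p θ / MultilevelToeplitz.qFun l α θ ∧ p θ / MultilevelToeplitz.qFun l α θ ≤ c₁)
    (n : Fin k → ℕ) [∀ r, NeZero (n r)] :
    IsUnit (MultilevelToeplitz.tau n
        (MultilevelToeplitz.toeplitz n (MultilevelToeplitz.rFun l α))).det ∧
      ∀ μ : ℂ,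
        Module.End.HasEigenvalue
          (Matrix.toLin'
            ((MultilevelToeplitz.tau n
                (MultilevelToeplitz.toeplitz n (MultilevelToeplitz.rFun l α)))⁻¹ *
              MultilevelToeplitz.toeplitz n p)) μ →
        μ.im = 0 ∧ c₀ / 2 ≤ μ.re ∧ μ.re ≤ 3 * Real.pi ^ 2 * c₁ / 8 := by
  have : (ae (volume.restrict (cube k))).NeBot :=
    ae_neBot.2 fun h => volume_cube_ne_zero k (Measure.restrict_eq_zero.1 h)
  obtain ⟨θ, hθ0, hθ1⟩ := hpq.exists
  have hc₁ : 0 < c₁ := hc₀.trans_le (hθ0.trans hθ1)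
  -- For `k = 0` the function `q` is the empty sum, and the convention `x / 0 = 0` contradicts `0 <
  -- c₀`.
  have hk : k ≠ 0 := by
    rintro rfl
    simp only [qFun, Finset.univ_eq_empty, Finset.sum_empty, div_zero] at hθ0
    linarith
  have hα0 : ∀ i, 0 < α i ∧ α i < 2 := fun i => ⟨zero_lt_one.trans (hα i).1, (hα i).2⟩
  have hunit : IsUnit (tau n (toeplitz n (rFun l α))).det := by
    rw [isUnit_iff_ne_zero]
    intro hdet
    obtain ⟨x, hx, hx0⟩ := exists_mulVec_eq_zero_iff.2 hdet
    obtain ⟨s, -, hs, -, hpos, -⟩ := exists_tau_form hk hα0 hl hx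
    rw [hx0, dotProduct_zero, eq_comm, Complex.ofReal_eq_zero] at hs
    exact hpos.ne' hs
  refine ⟨hunit, fun μ hμ => ?_⟩
  obtain ⟨x, hxμ, hx⟩ := hμ.exists_hasEigenvector
  have hB : toeplitz n p *ᵥ x = μ • tau n (toeplitz n (rFun l α)) *ᵥ x := by
    have h := Module.End.mem_eigenspace_iff.1 hxμ
    rw [toLin'_apply, ← mulVec_mulVec] at h
    rw [← mulVec_smul, ← h, mulVec_mulVec, mul_nonsing_inv _ hunit, one_mulVec]
  obtain ⟨s, a, hs, ha, hpos, hsa, has⟩ := exists_tau_form hk hα0 hl hx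
  have hbd : ∀ᵐ θ ∂(volume.restrict (cube k)),
      c₀ * rFun l α θ ≤ p θ ∧ p θ ≤ c₁ * (Real.pi ^ 2 / 4) * rFun l α θ := by
    filter_upwards [hpq, ae_restrict_mem (isCompact_cube k).measurableSet] with θ hθ hmem
    exact rFun_bounds (fun i => ⟨(hα0 i).1.le, (hα0 i).2.le⟩) (fun i => (hl i).le) hmem hc₀ hθ.1 hθ.2
  obtain ⟨b, hb, hab, hba⟩ := exists_toeplitz_form hp_int
    ((continuous_rFun fun i => (hα0 i).1.le).continuousOn.integrableOn_compact (isCompact_cube k))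
    hbd x ha
  rw [hB, dotProduct_smul, hs, smul_eq_mul] at hb
  -- Pairing `B x = μ τ(R) x` with `x` exhibits `μ` as a quotient of two real form values, which is
  -- why it is real.
  have hμb : μ = ((b / s : ℝ) : ℂ) := by
    rw [Complex.ofReal_div, eq_div_iff (Complex.ofReal_ne_zero.2 hpos.ne'), hb]
  rw [hμb, Complex.ofReal_im, Complex.ofReal_re, le_div_iff₀ hpos, div_le_iff₀ hpos]
  -- The lower constant is `c₀ · 1/2`, the upper one `c₁ (π²/4) · 3/2`.
  refine ⟨rfl, ?_, ?_⟩
  · have := mul_le_mul_of_nonneg_left hsa hc₀.le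
    linarith
  · have := mul_le_mul_of_nonneg_left has (by positivity : 0 ≤ c₁ * (Real.pi ^ 2 / 4))
    linarith
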